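/- Let $A=\mathbb{Q}\langle x_1,\dots,x_n \mid x_jx_i=c_{ij}\,x_ix_j+d_{ij},\ 1\le i<j\le n\rangle$ be a $G$-algebra over $\mathbb{Q}$ whose relations have integer coefficients. That is: the $c_{ij}$ are nonzero integers, and the $d_{ij}$ are standard polynomials with integer coefficients (finite sums $\sum_\alpha a_\alpha x^\alpha$ with $x^\alpha=x_1^{\alpha_1}\cdots x_n^{\alpha_n}$), such that 1. there is a monomial ordering $>$ on $\mathbb{N}^n$ (a total well-ordering compatible with addition) such that, for all $i<j$, either $d_{ij}=0$ or the leading exponent of $d_{ij}$ is smaller than $\epsilon_i+\epsilon_j$, where $\epsilon_i$ is the $i$-th unit vector; and 2. for all $i<j<k$ the element $c_{ik}c_{jk}\,d_{ij}x_k-x_kd_{ij}+c_{jk}\,x_jd_{ik}-c_{ij}\,d_{ik}x_j+d_{jk}x_i-c_{ij}c_{ik}\,x_id_{jk}$ of $\mathbb{Q}\langle x_1,\dots,x_n\rangle$ reduces to zero by finitely many replacements of subwords $x_jx_i$ ($i<j$) by $c_{ij}x_ix_j+d_{ij}$. Let $\omega\in\mathbb{N}_{\ge1}^n$ be such that, for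 all $i<j$, every monomial $x^\alpha$ occurring in $d_{ij}$ satisfies $\omega_1\alpha_1+\cdots+\omega_n\alpha_n=\omega_i+\omega_j$, so that $A$ is graded by the $\omega$-weighted degree. Let $I\subset A$ be a left ideal that is graded, i.e. $I=\bigoplus_{d\ge0}I_d$ with $I_d=I\cap A_d$, where $A_d$ is the space of $\omega$-homogeneous elements of degree $d$. Let $A_0\subset A$ be the set of elements $\sum_\alpha a_\alpha x^\alpha$ with all $a_\alpha\in\mathbb{Z}$. For a prime $p$, let $A_p$ be the $\mathbb{F}_p$-algebra generated by $x_1,\dots,x_n$ subject to the relations above with coefficients reduced modulo $p$. It is graded by the same weights; $(A_p)_d$ is the span of the $x^\alpha$ of weighted degree $d$. For $f=\sum_\alpha a_\alpha x^\alpha\in A_0$ put $f_p=\sum_\alpha (a_\alpha \bmod p)\,x^\alpha\in A_p$. Let $I_p$ be the left ideal of $A_p$ generated by all $f_p$ with $f\in I\cap A_0$, and let $(I_p)_d=I_p\cap (A_p)_d$. Write $H_I(d)=\dim_{\mathbb{Q}}I_d$ and $H_{I_p}(d)=\dim_{\mathbb{F}_p}(I_p)_d$. Then for every prime $p$ and every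 $d\in\mathbb{N}$, $$H_{I_p}(d)\le H_I(d).$$ -/

import Mathlib

noncomputable section

open scoped MonomialOrder

/-- Structure constants of commutation relations
`x_j x_i = c_ij x_i x_j + d_ij` for `i < j`, over a commutative ring `R`, in `n` variables.
Only the values at pairs `i < j` are ever used.  The standard polynomial
`d_ij = ∑ a_α x^α` (`x^α = x_1^{α_1} ⋯ x_n^{α_n}`, in this order) is recorded by its
coefficients `a_α`, that is, as an element of `MvPolynomial (Fin n) R`. -/
structure CommRelations (R : Type) [CommRing R] (n : ℕ) where
  c : Fin n → Fin n → R
  d : Fin n → Fin n → MvPolynomial (Fin n) R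

/-- The standard monomial `x^α = x_1^{α_1} ⋯ x_n^{α_n}` in the free associative algebra. -/
def stdMonomial (R : Type) [CommRing R] {n : ℕ} (α : Fin n →₀ ℕ) : FreeAlgebra R (Fin n) :=
  ((List.finRange n).map fun i => FreeAlgebra.ι R i ^ α i).prod

/-- The standard polynomial `∑ a_α x^α` in the free associative algebra with given
coefficients `a_α`. -/
def stdPoly (R : Type) [CommRing R] (n : ℕ) :
    MvPolynomial (Fin n) R →ₗ[R] FreeAlgebra R (Fin n) :=
  (MvPolynomial.basisMonomials (Fin n) R).constr R (stdMonomial R)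

/-- A word in the variables, as an element of the free associative algebra. -/
def freeWord (R : Type) [CommRing R] {n : ℕ} (w : FreeMonoid (Fin n)) : FreeAlgebra R (Fin n) :=
  FreeMonoid.lift (FreeAlgebra.ι R) w

/-- The coefficient of the word `w` in an element of the free associative algebra. -/
def wordCoeff {R : Type} [CommRing R] {n : ℕ} (f : FreeAlgebra R (Fin n))
    (w : FreeMonoid (Fin n)) : R :=
  (FreeAlgebra.basisFreeMonoid R (Fin n)).repr f w

namespace CommRelations

section Basic

variable {R : Type} [CommRing R] {n : ℕ} (D : CommRelations R n)

/-- The right-hand side `c_ij x_i x_j + d_ij` of the relation, in the free algebra. -/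
def rhs (i j : Fin n) : FreeAlgebra R (Fin n) :=
  D.c i j • (FreeAlgebra.ι R i * FreeAlgebra.ι R j) + stdPoly R n (D.d i j)

/-- The relations `x_j x_i = c_ij x_i x_j + d_ij`, `i < j`. -/
inductive Rel : FreeAlgebra R (Fin n) → FreeAlgebra R (Fin n) → Prop
  | comm (i j : Fin n) (hij : i < j) :
      Rel (FreeAlgebra.ι R j * FreeAlgebra.ι R i) (D.rhs i j)

/-- The algebra `R⟨x_1, …, x_n ∣ x_j x_i = c_ij x_i x_j + d_ij, i < j⟩`. -/
abbrev Alg : Type := RingQuot D.Rel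

/-- The class in `D.Alg` of the standard polynomial with given coefficients. -/
def std : MvPolynomial (Fin n) R →ₗ[R] D.Alg :=
  (RingQuot.mkAlgHom R D.Rel).toLinearMap ∘ₗ stdPoly R n

/-- One reduction step with respect to the relations of `D`: for some `i < j` and words `u`, `v`,
the term of `f` at the word `u x_j x_i v`, with its coefficient, is replaced by the same multiple of
`u (c_ij x_i x_j + d_ij) v`. -/
def ReducesStep (f g : FreeAlgebra R (Fin n)) : Prop :=
  ∃ i j : Fin n, i < j ∧ ∃ u v : FreeMonoid (Fin n),
    g = f - wordCoeff f (u * FreeMonoid.of j * FreeMonoid.of i * v) •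
      (freeWord R u * (FreeAlgebra.ι R j * FreeAlgebra.ι R i - D.rhs i j) * freeWord R v)

/-- `f` reduces to zero with respect to the relations of `D`: finitely many reduction steps lead
from `f` to `0`. -/
def ReducesToZero (f : FreeAlgebra R (Fin n)) : Prop :=
  Relation.ReflTransGen D.ReducesStep f 0

/-- The element
`c_ik c_jk d_ij x_k - x_k d_ij + c_jk x_j d_ik - c_ij d_ik x_j + d_jk x_i - c_ij c_ik x_i d_jk`
of the free algebra. -/
def nondegeneracy (i j k : Fin n) : FreeAlgebra R (Fin n) :=
  (D.c i k * D.c j k) • (stdPoly R n (D.d i j) * FreeAlgebra.ι R k)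
    - FreeAlgebra.ι R k * stdPoly R n (D.d i j)
    + D.c j k • (FreeAlgebra.ι R j * stdPoly R n (D.d i k))
    - D.c i j • (stdPoly R n (D.d i k) * FreeAlgebra.ι R j)
    + stdPoly R n (D.d j k) * FreeAlgebra.ι R i
    - (D.c i j * D.c i k) • (FreeAlgebra.ι R i * stdPoly R n (D.d j k))

/-- The monomial ordering `m` is admissible: `d_ij = 0` or `exp (d_ij) < ε_i + ε_j`
for all `i < j`. -/
def IsAdmissible (m : MonomialOrder.{0, 0} (Fin n)) : Prop :=
  ∀ i j : Fin n, i < j →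
    D.d i j = 0 ∨ m.degree (D.d i j) ≺[m] (Finsupp.single i 1 + Finsupp.single j 1)

/-- The algebra presented by `D` is a `G`-algebra (used over a field). -/
structure IsGAlgebra : Prop where
  c_ne_zero : ∀ i j : Fin n, i < j → D.c i j ≠ 0
  exists_admissible : ∃ m : MonomialOrder.{0, 0} (Fin n), D.IsAdmissible m
  nondegenerate : ∀ i j k : Fin n, i < j → j < k → D.ReducesToZero (D.nondegeneracy i j k)

/-- The relations are `ω`-homogeneous: every monomial `x^α` occurring in `d_ij`, `i < j`, has
weighted degree `ω_i + ω_j`. -/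
def IsGradedBy (ω : Fin n → ℕ) : Prop :=
  ∀ i j : Fin n, i < j → (D.d i j).IsWeightedHomogeneous ω (ω i + ω j)

/-- The `R`-module of `ω`-homogeneous elements of degree `e`: the elements `∑ a_α x^α` with
`ω_1 α_1 + ⋯ + ω_n α_n = e` whenever `a_α ≠ 0`. -/
def homogeneousPart (ω : Fin n → ℕ) (e : ℕ) : Submodule R D.Alg :=
  (MvPolynomial.weightedHomogeneousSubmodule R ω e).map D.std

/-- The degree `e` piece `I_e = I ∩ A_e` of a left ideal. -/
def idealPart (ω : Fin n → ℕ) (I : Ideal D.Alg) (e : ℕ) : Submodule R D.Alg :=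
  I.restrictScalars R ⊓ D.homogeneousPart ω e

/-- The left ideal `I` is graded: it is the sum of its pieces `I_e`. -/
def IsGradedIdeal (ω : Fin n → ℕ) (I : Ideal D.Alg) : Prop :=
  I.restrictScalars R = ⨆ e : ℕ, D.idealPart ω I e

/-- The Hilbert function `e ↦ dim I_e` (used over a field). -/
def hilbertFunction (ω : Fin n → ℕ) (I : Ideal D.Alg) (e : ℕ) : ℕ :=
  Module.finrank R (D.idealPart ω I e)

/-- For positive weights over a noetherian ring, in particular over a field, the pieces `I_e` are
finitely generated, so that `Module.finrank` is their true dimension in `hilbertFunction`. -/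
theorem idealPart_finite [IsNoetherianRing R] {ω : Fin n → ℕ} (hω : ∀ i, 1 ≤ ω i)
    (I : Ideal D.Alg) (e : ℕ) : Module.Finite R (D.idealPart ω I e) := by
  have h1 : (D.homogeneousPart ω e).FG :=
    (MvPolynomial.weightedHomogeneousSubmodule_fg (R := R) ω
      (fun i => Nat.one_le_iff_ne_zero.mp (hω i)) e).map D.std
  have h2 : IsNoetherian R (D.homogeneousPart ω e) :=
    isNoetherian_of_fg_of_noetherian _ h1
  have h3 : IsNoetherian R (D.idealPart ω I e) := isNoetherian_of_le inf_le_right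
  infer_instance

end Basic

section Integral

variable {n : ℕ} (D : CommRelations ℤ n)

/-- Relations with integer coefficients, read over a commutative ring `S` (such as `ℚ`
or `ℤ/Nℤ`). -/
def baseChange (S : Type) [CommRing S] : CommRelations S n where
  c i j := (D.c i j : S)
  d i j := MvPolynomial.map (Int.castRingHom S) (D.d i j)

/-- The standard polynomial with integer coefficients `a_α`, read in the algebra over `S`. -/
def intStd (S : Type) [CommRing S] (a : MvPolynomial (Fin n) ℤ) : (D.baseChange S).Alg :=
  (D.baseChange S).std (MvPolynomial.map (Int.castRingHom S) a)

/-- The elements of `A = ℚ⟨x ∣ C⟩` with integer coefficients. -/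
def integralElements : Set (D.baseChange ℚ).Alg :=
  {f | ∃ a : MvPolynomial (Fin n) ℤ, f = D.intStd ℚ a}

/-- `g` is the reduction modulo `N` of an element `f` with integer coefficients:
`f = ∑ a_α x^α` with `a_α ∈ ℤ`, and `g = ∑ (a_α mod N) x^α`. -/
def IsReductionMod (N : ℕ) (f : (D.baseChange ℚ).Alg) (g : (D.baseChange (ZMod N)).Alg) : Prop :=
  ∃ a : MvPolynomial (Fin n) ℤ, f = D.intStd ℚ a ∧ g = D.intStd (ZMod N) a

/-- The reduction `I_N` of a left ideal `I ⊆ A`: the left ideal generated by the reductions modulo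
`N` of the elements of `I` with integer coefficients. -/
def reductionMod (N : ℕ) (I : Ideal (D.baseChange ℚ).Alg) : Ideal (D.baseChange (ZMod N)).Alg :=
  Ideal.span {g | ∃ f ∈ (I : Set (D.baseChange ℚ).Alg) ∩ D.integralElements, D.IsReductionMod N f g}

end Integral

end CommRelations

end

noncomputable section
open scoped MonomialOrder

/-! Both Hilbert functions are compared with the rank of one lattice, the integer coefficient
vectors of the degree `e` elements of `I` (`integralPart`). The lattice embeds in `I_e`, because
standard monomials are linearly independent over `ℚ` (`std_injective`); images of a `ℤ`-basis are
then `ℚ`-independent, so the rank is at most `dim I_e`. Reduction modulo `p` maps the lattice onto a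
group containing `(I_p)_e`, so that `dim (I_p)_e` is at most the rank. Two facts give this.
Reductions of integral elements of `I` already form a left ideal (`exists_of_mem_reductionMod`),
since products of standard polynomials can be straightened over `ℤ`. And taking homogeneous
components commutes with reduction (`homogeneousProj_intStd`).

Independence is Bergman's diamond lemma: a linear normal form on the free algebra is built by
recursion on words, and shown not to depend on the descent rewritten at each word. Over `ℤ` and
modulo `p` the argument only needs that standard monomials span, which follows from admissibility
alone. -/

theorem Module.Basis.exists_linearMap_eq_add_of_wellFounded {ι R F M : Type*} [CommRing R]
    [AddCommGroup F] [Module R F] [AddCommGroup M] [Module R M] (b : Module.Basis ι R F)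
    {r : ι → ι → Prop} (hr : WellFounded r) (f : ι → F)
    (hf : ∀ i, f i ∈ Submodule.span R (b '' {j | r j i})) (g : ι → M) :
    ∃ N : F →ₗ[R] M, ∀ i, N (b i) = N (f i) + g i := by
  classical
  -- The default `0` for indices not below `i` is never used: by `hf`, every index in the support of
  -- `f i` is below `i`.
  let Nw : ι → M := hr.fix fun i rec =>
    ((b.repr (f i)).sum fun j a => if h : r j i then a • rec j h else 0) + g i
  refine ⟨b.constr R Nw, fun i => ?_⟩
  rw [Module.Basis.constr_basis, Module.Basis.constr_apply]
  have h1 : Nw i = ((b.repr (f i)).sum fun j a => if r j i then a • Nw j else 0) + g i := by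
    simp only [Nw]
    rw [hr.fix_eq]
    simp only [dite_eq_ite]
  rw [h1]
  congr 1
  refine Finsupp.sum_congr fun j hj => ?_
  have : Nontrivial R := ⟨_, _, Finsupp.mem_support_iff.mp hj⟩
  exact if_pos (b.mem_span_image.mp (hf i) hj)

/-! ### Words, their exponent vectors and a well-founded order. -/

section Words

variable {n : ℕ}

/-- The exponent vector of a word. -/
def wordExp (w : FreeMonoid (Fin n)) : Fin n →₀ ℕ :=
  Multiset.toFinsupp (w.toList : Multiset (Fin n))

theorem wordExp_mul (u v : FreeMonoid (Fin n)) : wordExp (u * v) = wordExp u + wordExp v := by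
  simp [wordExp, FreeMonoid.toList_mul, ← Multiset.coe_add]

@[simp] theorem wordExp_one : wordExp (1 : FreeMonoid (Fin n)) = 0 := by
  simp [wordExp]

@[simp] theorem wordExp_of (i : Fin n) : wordExp (FreeMonoid.of i) = Finsupp.single i 1 := by
  simp [wordExp, Multiset.toFinsupp_singleton]

theorem perm_of_wordExp_eq {u v : FreeMonoid (Fin n)} (h : wordExp u = wordExp v) :
    u.toList.Perm v.toList :=
  Multiset.coe_eq_coe.mp (Multiset.toFinsupp.injective h)

/-- A position weighted sum of the letters of a word; it drops when two neighbouring letters are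
put in increasing order. -/
def disorder : List (Fin n) → ℕ
  | [] => 0
  | a :: l => disorder l + a * l.length

theorem disorder_append (u v : List (Fin n)) :
    disorder (u ++ v) = disorder u + (u.map Fin.val).sum * v.length + disorder v := by
  induction u with
  | nil => simp [disorder]
  | cons a u ih => simp [disorder, ih]; ring

/-- The order on words: first by exponent vector, then by `disorder`. -/
def WordLT (m : MonomialOrder.{0, 0} (Fin n)) (u v : FreeMonoid (Fin n)) : Prop :=
  m.toSyn (wordExp u) < m.toSyn (wordExp v) ∨
    wordExp u = wordExp v ∧ disorder u.toList < disorder v.toList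

theorem wellFounded_wordLT (m : MonomialOrder.{0, 0} (Fin n)) : WellFounded (WordLT m) := by
  have h := InvImage.wf (fun w : FreeMonoid (Fin n) => (m.toSyn (wordExp w), disorder w.toList))
    (WellFounded.prod_lex (wellFounded_lt (α := m.syn)) (wellFounded_lt (α := ℕ)))
  refine Subrelation.wf ?_ h
  rintro u v (h | ⟨h1, h2⟩)
  · exact Prod.Lex.left _ _ h
  · simp only [InvImage, h1]
    exact Prod.Lex.right _ h2

theorem WordLT.trans {m : MonomialOrder.{0, 0} (Fin n)} {s t u : FreeMonoid (Fin n)}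
    (h : WordLT m s t) (h' : WordLT m t u) : WordLT m s u := by
  rcases h with h | ⟨h1, h2⟩ <;> rcases h' with h' | ⟨h3, h4⟩
  · exact Or.inl (h.trans h')
  · exact Or.inl (h3 ▸ h)
  · exact Or.inl (h1 ▸ h')
  · exact Or.inr ⟨h1.trans h3, h2.trans h4⟩

theorem WordLT.mul {m : MonomialOrder.{0, 0} (Fin n)} {s t : FreeMonoid (Fin n)}
    (h : WordLT m s t) (u v : FreeMonoid (Fin n)) : WordLT m (u * s * v) (u * t * v) := by
  rcases h with h | ⟨h1, h2⟩
  · left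
    simp only [wordExp_mul, map_add]
    gcongr
  · right
    refine ⟨by simp only [wordExp_mul, h1], ?_⟩
    -- Words with equal exponents have equal length and letter sum, so the surroundings `u`, `v` add
    -- the same amount to both disorders.
    have hp := perm_of_wordExp_eq h1
    have hl := hp.length_eq
    have hs := (hp.map Fin.val).sum_eq
    simp only [FreeMonoid.toList_mul, disorder_append, List.map_append, List.sum_append, hl, hs]
    omega

theorem wordLT_swap (m : MonomialOrder.{0, 0} (Fin n)) {i j : Fin n} (h : i < j) :
    WordLT m (FreeMonoid.of i * FreeMonoid.of j) (FreeMonoid.of j * FreeMonoid.of i) := by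
  right
  refine ⟨by simp only [wordExp_mul, add_comm], ?_⟩
  simp [disorder, FreeMonoid.toList_mul, h]

theorem isChain_or_exists_descent (w : FreeMonoid (Fin n)) :
    w.toList.IsChain (· ≤ ·) ∨ ∃ (u v : FreeMonoid (Fin n)) (i j : Fin n), i < j ∧
      w = u * FreeMonoid.of j * FreeMonoid.of i * v := by
  by_cases h : w.toList.IsChain (· ≤ ·)
  · exact Or.inl h
  · right
    rw [List.isChain_iff_forall_rel_of_append_cons_cons] at h
    push Not at h
    obtain ⟨a, b, l₁, l₂, h1, h2⟩ := h
    refine ⟨FreeMonoid.ofList l₁, FreeMonoid.ofList l₂, b, a, h2, ?_⟩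
    apply FreeMonoid.toList.injective
    simp [h1, FreeMonoid.toList_mul]

/-- The standard word with exponent vector `α`. -/
def stdWord (α : Fin n →₀ ℕ) : FreeMonoid (Fin n) :=
  ((List.finRange n).map fun i => FreeMonoid.of i ^ α i).prod

@[simp] theorem wordExp_stdWord (α : Fin n →₀ ℕ) : wordExp (stdWord α) = α := by
  let φ : FreeMonoid (Fin n) →* Multiplicative (Fin n →₀ ℕ) :=
    { toFun := fun w => Multiplicative.ofAdd (wordExp w)
      map_one' := by simp
      map_mul' := fun u v => by simp [wordExp_mul] }
  have h : φ (stdWord α) = Multiplicative.ofAdd (∑ i, α i • Finsupp.single i 1) := by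
    rw [stdWord, map_list_prod, List.map_map, ofAdd_sum, ← List.ofFn_eq_map, List.prod_ofFn]
    refine Finset.prod_congr rfl fun i _ => ?_
    rw [Function.comp_apply, map_pow, ofAdd_nsmul]
    simp [φ]
  have h2 : wordExp (stdWord α) = ∑ i, α i • Finsupp.single i 1 :=
    Multiplicative.ofAdd.injective h
  rw [h2]
  simp [Finsupp.univ_sum_single α]

theorem toList_of_pow (i : Fin n) (k : ℕ) :
    (FreeMonoid.of i ^ k).toList = List.replicate k i := by
  induction k with
  | zero => rfl
  | succ k ih => rw [pow_succ', FreeMonoid.toList_mul, ih]; rfl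

theorem pairwise_le_stdWord (α : Fin n →₀ ℕ) : (stdWord α).toList.Pairwise (· ≤ ·) := by
  -- The claim about membership is carried along so that the head of the list can be compared with
  -- the letters of the tail.
  have h : ∀ l : List (Fin n), l.Pairwise (· < ·) →
      ((l.map fun i => FreeMonoid.of i ^ α i).prod).toList.Pairwise (· ≤ ·) ∧
      ∀ x ∈ ((l.map fun i => FreeMonoid.of i ^ α i).prod).toList, x ∈ l := by
    intro l hl
    induction l with
    | nil => simp
    | cons a l ih =>
      rw [List.pairwise_cons] at hl
      obtain ⟨h1, h2⟩ := ih hl.2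
      simp only [List.map_cons, List.prod_cons, FreeMonoid.toList_mul, toList_of_pow]
      constructor
      · rw [List.pairwise_append]
        refine ⟨by simp [List.pairwise_replicate], h1, fun x hx y hy => ?_⟩
        rw [List.eq_of_mem_replicate hx]
        exact (hl.1 y (h2 y hy)).le
      · intro x hx
        rcases List.mem_append.mp hx with hx | hx
        · rw [List.eq_of_mem_replicate hx]; simp
        · exact List.mem_cons_of_mem _ (h2 x hx)
  exact (h _ (List.pairwise_lt_finRange n)).1

theorem eq_stdWord_of_isChain {w : FreeMonoid (Fin n)} (h : w.toList.IsChain (· ≤ ·)) :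
    w = stdWord (wordExp w) := by
  apply FreeMonoid.toList.injective
  exact List.Perm.eq_of_pairwise' (List.isChain_iff_pairwise.mp h) (pairwise_le_stdWord _)
    (perm_of_wordExp_eq (by simp))

theorem not_isChain_descent {i j : Fin n} (hij : i < j) (u v : FreeMonoid (Fin n)) :
    ¬ (u * FreeMonoid.of j * FreeMonoid.of i * v).toList.IsChain (· ≤ ·) := by
  intro h
  rw [List.isChain_iff_forall_rel_of_append_cons_cons] at h
  exact absurd (@h j i u.toList v.toList (by simp [FreeMonoid.toList_mul])) (not_le.mpr hij)

end Words

/-! ### Words as a basis of the free algebra. -/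

section FreeWords

variable {R : Type} [CommRing R] {n : ℕ}

theorem basisFreeMonoid_apply (w : FreeMonoid (Fin n)) :
    FreeAlgebra.basisFreeMonoid R (Fin n) w = freeWord R w := by
  simp [FreeAlgebra.basisFreeMonoid, freeWord, FreeAlgebra.equivMonoidAlgebraFreeMonoid]

theorem freeWord_mul (u v : FreeMonoid (Fin n)) :
    freeWord R (u * v) = freeWord R u * freeWord R v :=
  map_mul _ _ _

@[simp] theorem freeWord_one : freeWord R (1 : FreeMonoid (Fin n)) = 1 := map_one _

@[simp] theorem freeWord_of (i : Fin n) : freeWord R (FreeMonoid.of i) = FreeAlgebra.ι R i :=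
  FreeMonoid.lift_eval_of _ _

theorem stdMonomial_eq_freeWord (α : Fin n →₀ ℕ) :
    stdMonomial R α = freeWord R (stdWord α) := by
  rw [stdMonomial, stdWord, freeWord, map_list_prod, List.map_map]
  congr 1
  refine List.map_congr_left fun i _ => ?_
  simp [map_pow]

theorem stdPoly_monomial (α : Fin n →₀ ℕ) (r : R) :
    stdPoly R n (MvPolynomial.monomial α r) = r • stdMonomial R α := by
  have h : (MvPolynomial.monomial α r : MvPolynomial (Fin n) R)
      = r • MvPolynomial.basisMonomials (Fin n) R α := by
    simp [MvPolynomial.smul_monomial]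
  rw [h, map_smul, stdPoly, Module.Basis.constr_basis]

theorem stdPoly_mem_span {s : Set (FreeMonoid (Fin n))} (a : MvPolynomial (Fin n) R)
    (h : ∀ α ∈ a.support, stdWord α ∈ s) :
    stdPoly R n a ∈ Submodule.span R (freeWord R '' s) := by
  rw [a.as_sum, map_sum]
  refine Submodule.sum_mem _ fun α hα => ?_
  rw [stdPoly_monomial, stdMonomial_eq_freeWord]
  exact Submodule.smul_mem _ _ (Submodule.subset_span ⟨_, h α hα, rfl⟩)

theorem mem_span_freeWord_iff [Nontrivial R] {s : Set (FreeMonoid (Fin n))}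
    {f : FreeAlgebra R (Fin n)} :
    f ∈ Submodule.span R (freeWord R '' s) ↔ ∀ w, wordCoeff f w ≠ 0 → w ∈ s := by
  have h : freeWord R '' s = FreeAlgebra.basisFreeMonoid R (Fin n) '' s :=
    Set.image_congr fun w _ => (basisFreeMonoid_apply w).symm
  rw [h, Module.Basis.mem_span_image]
  simp [Set.subset_def, wordCoeff]

theorem mul_mem_span_freeWord {s t : Set (FreeMonoid (Fin n))} {f : FreeAlgebra R (Fin n)}
    (u v : FreeMonoid (Fin n)) (hf : f ∈ Submodule.span R (freeWord R '' s))
    (h : ∀ w ∈ s, u * w * v ∈ t) :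
    freeWord R u * f * freeWord R v ∈ Submodule.span R (freeWord R '' t) := by
  induction hf using Submodule.span_induction with
  | mem x hx =>
    obtain ⟨w, hw, rfl⟩ := hx
    rw [← freeWord_mul, ← freeWord_mul]
    exact Submodule.subset_span ⟨_, h w hw, rfl⟩
  | zero => simp
  | add x y _ _ hx hy => rw [mul_add, add_mul]; exact Submodule.add_mem _ hx hy
  | smul a x _ hx => rw [mul_smul_comm, smul_mul_assoc]; exact Submodule.smul_mem _ _ hx

end FreeWords
end

/-! ### Normal forms and the resolution of ambiguities. -/

noncomputable section
open scoped MonomialOrder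

namespace CommRelations

variable {R : Type} [CommRing R] {n : ℕ} (D : CommRelations R n)

variable {D} in
theorem IsAdmissible.lt_of_mem_support {m : MonomialOrder.{0, 0} (Fin n)} (hm : D.IsAdmissible m)
    {i j : Fin n} (hij : i < j) {α : Fin n →₀ ℕ} (hα : α ∈ (D.d i j).support) :
    α ≺[m] (Finsupp.single i 1 + Finsupp.single j 1) := by
  rcases hm i j hij with h | h
  · simp [h] at hα
  · exact (m.le_degree hα).trans_lt h

/-- The word `x_i x_j` is lower by `disorder`, the words of `d_ij` by their exponents. -/
theorem rhs_mem_span {m : MonomialOrder.{0, 0} (Fin n)} (hm : D.IsAdmissible m)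
    {i j : Fin n} (hij : i < j) :
    D.rhs i j ∈ Submodule.span R
      (freeWord R '' {t | WordLT m t (FreeMonoid.of j * FreeMonoid.of i)}) := by
  refine Submodule.add_mem _ (Submodule.smul_mem _ _ (Submodule.subset_span
    ⟨FreeMonoid.of i * FreeMonoid.of j, wordLT_swap m hij, ?_⟩)) (stdPoly_mem_span _ ?_)
  · simp [freeWord_mul]
  · intro α hα
    left
    simpa [wordExp_mul, add_comm] using hm.lt_of_mem_support hij hα

/-- The difference of the two sides of the relation for `i < j`. -/
def relator (i j : Fin n) : FreeAlgebra R (Fin n) :=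
  FreeAlgebra.ι R j * FreeAlgebra.ι R i - D.rhs i j

/-- Fixing one descent in each unsorted word and rewriting there defines `N` recursively. Only the
relator multiples at the chosen descents are killed by construction; the other descents are the
content of the diamond lemma. -/
theorem exists_normalForm {m : MonomialOrder.{0, 0} (Fin n)} (hm : D.IsAdmissible m) :
    ∃ N : FreeAlgebra R (Fin n) →ₗ[R] MvPolynomial (Fin n) R,
      (∀ α, N (stdMonomial R α) = MvPolynomial.monomial α 1) ∧
      ∀ w : FreeMonoid (Fin n), ¬ w.toList.IsChain (· ≤ ·) → ∃ u v i j, i < j ∧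
        w = u * FreeMonoid.of j * FreeMonoid.of i * v ∧
        N (freeWord R u * D.relator i j * freeWord R v) = 0 := by
  classical
  have hstep : ∀ w : FreeMonoid (Fin n), ∃ f : FreeAlgebra R (Fin n),
      f ∈ Submodule.span R (freeWord R '' {t | WordLT m t w}) ∧
      (w.toList.IsChain (· ≤ ·) → f = 0) ∧
      (¬ w.toList.IsChain (· ≤ ·) → ∃ u v i j, i < j ∧
        w = u * FreeMonoid.of j * FreeMonoid.of i * v ∧
        f = freeWord R u * D.rhs i j * freeWord R v) := by
    intro w
    by_cases h : w.toList.IsChain (· ≤ ·)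
    · exact ⟨0, Submodule.zero_mem _, fun _ => rfl, fun h' => absurd h h'⟩
    · obtain ⟨u, v, i, j, hij, hw⟩ := (isChain_or_exists_descent w).resolve_left h
      refine ⟨freeWord R u * D.rhs i j * freeWord R v, ?_, fun h' => absurd h' h,
        fun _ => ⟨u, v, i, j, hij, hw, rfl⟩⟩
      refine mul_mem_span_freeWord u v (D.rhs_mem_span hm hij) fun t ht => ?_
      rw [hw, mul_assoc u]
      exact WordLT.mul ht u v
  choose f hf1 hf2 hf3 using hstep
  have hb : ∀ w, FreeAlgebra.basisFreeMonoid R (Fin n) w = freeWord R w := basisFreeMonoid_apply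
  obtain ⟨N, hN⟩ := (FreeAlgebra.basisFreeMonoid R (Fin n)).exists_linearMap_eq_add_of_wellFounded
    (wellFounded_wordLT m) f (by simpa only [funext hb] using hf1)
    (fun w => if w.toList.IsChain (· ≤ ·) then
      (MvPolynomial.monomial (wordExp w) 1 : MvPolynomial (Fin n) R) else 0)
  simp only [hb] at hN
  refine ⟨N, fun α => ?_, fun w hw => ?_⟩
  · have hc := (List.isChain_iff_pairwise.mpr (pairwise_le_stdWord α))
    rw [stdMonomial_eq_freeWord, hN, hf2 _ hc, if_pos hc, map_zero, zero_add, wordExp_stdWord]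
  · obtain ⟨u, v, i, j, hij, hw', hfe⟩ := hf3 w hw
    refine ⟨u, v, i, j, hij, hw', ?_⟩
    have h1 := hN w
    rw [if_neg hw, add_zero, hfe] at h1
    rw [relator, mul_sub, sub_mul, map_sub, sub_eq_zero, ← h1, hw']
    simp [freeWord_mul, mul_assoc]

section Diamond

variable {m : MonomialOrder.{0, 0} (Fin n)} {M : Type} [AddCommGroup M] [Module R M]
  {N : FreeAlgebra R (Fin n) →ₗ[R] M}

/-- A linear map on the free algebra is compatible with the relations at all words `w` satisfying
`P` if it kills every multiple of a relator with leading word `w`. -/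
def KillsRelators (N : FreeAlgebra R (Fin n) →ₗ[R] M) (P : FreeMonoid (Fin n) → Prop) : Prop :=
  ∀ (u v : FreeMonoid (Fin n)) (i j : Fin n), i < j →
    P (u * FreeMonoid.of j * FreeMonoid.of i * v) →
    N (freeWord R u * D.relator i j * freeWord R v) = 0

variable {D}

theorem KillsRelators.map_eq_zero {P : FreeMonoid (Fin n) → Prop} (h : D.KillsRelators N P)
    {i j : Fin n} (hij : i < j) (u v w : FreeMonoid (Fin n)) {s : Set (FreeMonoid (Fin n))}
    {f : FreeAlgebra R (Fin n)} (hf : f ∈ Submodule.span R (freeWord R '' s))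
    (hl : ∀ t ∈ s, P (u * t * v * FreeMonoid.of j * FreeMonoid.of i * w)) :
    N (freeWord R u * f * freeWord R v * D.relator i j * freeWord R w) = 0 := by
  induction hf using Submodule.span_induction with
  | mem x hx =>
    obtain ⟨t, ht, rfl⟩ := hx
    rw [← freeWord_mul, ← freeWord_mul]
    exact h _ _ i j hij (hl t ht)
  | zero => simp
  | add x y _ _ hx hy => simp only [mul_add, add_mul, map_add, hx, hy, add_zero]
  | smul a x _ hx => simp only [mul_smul_comm, smul_mul_assoc, map_smul, hx, smul_zero]

theorem KillsRelators.map_eq_zero' {P : FreeMonoid (Fin n) → Prop} (h : D.KillsRelators N P)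
    {i j : Fin n} (hij : i < j) (u v w : FreeMonoid (Fin n)) {s : Set (FreeMonoid (Fin n))}
    {f : FreeAlgebra R (Fin n)} (hf : f ∈ Submodule.span R (freeWord R '' s))
    (hr : ∀ t ∈ s, P (u * FreeMonoid.of j * FreeMonoid.of i * v * t * w)) :
    N (freeWord R u * D.relator i j * freeWord R v * f * freeWord R w) = 0 := by
  induction hf using Submodule.span_induction with
  | mem x hx =>
    obtain ⟨t, ht, rfl⟩ := hx
    have := h u (v * t * w) i j hij (by simpa only [mul_assoc] using hr t ht)
    simpa only [freeWord_mul, mul_assoc] using this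
  | zero => simp
  | add x y _ _ hx hy => simp only [mul_add, add_mul, map_add, hx, hy, add_zero]
  | smul a x _ hx => simp only [mul_smul_comm, smul_mul_assoc, map_smul, hx, smul_zero]

/-- Two disjoint descents of a word. -/
theorem KillsRelators.disjoint (hm : D.IsAdmissible m) {i j k l : Fin n} (hij : i < j)
    (hkl : k < l) (u v w : FreeMonoid (Fin n))
    (h : D.KillsRelators N fun t => WordLT m t
      (u * FreeMonoid.of j * FreeMonoid.of i * v * FreeMonoid.of l * FreeMonoid.of k * w)) :
    N (freeWord R u * D.relator i j *
        freeWord R (v * FreeMonoid.of l * FreeMonoid.of k * w)) =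
      N (freeWord R (u * FreeMonoid.of j * FreeMonoid.of i * v) * D.relator k l *
        freeWord R w) := by
  have h1 := h.map_eq_zero hkl u v w (D.rhs_mem_span hm hij) fun t ht => by
    simpa only [mul_assoc] using
      WordLT.mul ht u (v * FreeMonoid.of l * FreeMonoid.of k * w)
  have h2 := h.map_eq_zero' hij u v w (D.rhs_mem_span hm hkl) fun t ht => by
    simpa only [mul_assoc] using
      WordLT.mul ht (u * FreeMonoid.of j * FreeMonoid.of i * v) w
  -- With `r = a - a'` and `s = b - b'`, both `r v b - a v s` and `r v b' - a' v s` equal `a v b' -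
  -- a' v b`; the terms of the second involve only lower words.
  rw [← sub_eq_zero, ← map_sub, ← sub_eq_zero.mpr (h2.trans h1.symm), ← map_sub]
  congr 1
  simp only [relator, freeWord_mul, freeWord_of]
  noncomm_ring

/-- Each summand is some `d_ab` times the third variable, so its exponents lie strictly below that
of `x_k x_j x_i`. This lets the induction hypothesis apply to its whole reduction. -/
theorem nondegeneracy_mem_span [Nontrivial R] (hm : D.IsAdmissible m) {i j k : Fin n}
    (hij : i < j) (hjk : j < k) :
    D.nondegeneracy i j k ∈ Submodule.span R (freeWord R '' {t | wordExp t ≺[m]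
      (Finsupp.single i 1 + Finsupp.single j 1 + Finsupp.single k 1)}) := by
  have hd : ∀ {a b : Fin n}, a < b → stdPoly R n (D.d a b) ∈ Submodule.span R (freeWord R ''
      {t | wordExp t ≺[m] (Finsupp.single a 1 + Finsupp.single b 1)}) := fun hab =>
    stdPoly_mem_span _ fun α hα => by simpa using hm.lt_of_mem_support hab hα
  have hl : ∀ {a b c : Fin n}, a < b → Finsupp.single a 1 + Finsupp.single b 1 +
      Finsupp.single c 1 = (Finsupp.single i 1 + Finsupp.single j 1 + Finsupp.single k 1 :
        Fin n →₀ ℕ) →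
      stdPoly R n (D.d a b) * FreeAlgebra.ι R c ∈ Submodule.span R (freeWord R '' {t | wordExp t ≺[m]
      (Finsupp.single i 1 + Finsupp.single j 1 + Finsupp.single k 1)}) := by
    intro a b c hab he
    have := mul_mem_span_freeWord (t := {t | wordExp t ≺[m]
      (Finsupp.single i 1 + Finsupp.single j 1 + Finsupp.single k 1)}) 1 (FreeMonoid.of c) (hd hab)
      (fun t ht => by
        rw [← he]
        simp only [Set.mem_ofPred_eq, wordExp_mul, wordExp_one, wordExp_of, zero_add] at ht ⊢
        rw [map_add, map_add _ _ (Finsupp.single c 1)]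
        gcongr)
    simpa using this
  have hr : ∀ {a b c : Fin n}, a < b → Finsupp.single a 1 + Finsupp.single b 1 +
      Finsupp.single c 1 = (Finsupp.single i 1 + Finsupp.single j 1 + Finsupp.single k 1 :
        Fin n →₀ ℕ) →
      FreeAlgebra.ι R c * stdPoly R n (D.d a b) ∈ Submodule.span R (freeWord R '' {t | wordExp t ≺[m]
      (Finsupp.single i 1 + Finsupp.single j 1 + Finsupp.single k 1)}) := by
    intro a b c hab he
    have := mul_mem_span_freeWord (t := {t | wordExp t ≺[m]
      (Finsupp.single i 1 + Finsupp.single j 1 + Finsupp.single k 1)}) (FreeMonoid.of c) 1 (hd hab)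
      (fun t ht => by
        rw [← he]
        simp only [Set.mem_ofPred_eq, wordExp_mul, wordExp_one, wordExp_of, add_zero] at ht ⊢
        rw [map_add, map_add _ _ (Finsupp.single c 1), add_comm]
        gcongr)
    simpa using this
  have hik := hij.trans hjk
  unfold nondegeneracy
  refine Submodule.sub_mem _ (Submodule.add_mem _ (Submodule.sub_mem _ (Submodule.add_mem _
    (Submodule.sub_mem _ (Submodule.smul_mem _ _ (hl hij rfl)) (hr hij rfl))
    (Submodule.smul_mem _ _ (hr hik ?_))) (Submodule.smul_mem _ _ (hl hik ?_))) (hl hjk ?_))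
    (Submodule.smul_mem _ _ (hr hjk ?_)) <;> abel

/-- A step at a word that occurs in `f` subtracts a relator multiple supported below `β`: `N` does
not see it, and the support bound survives. -/
theorem KillsRelators.map_reducesToZero [Nontrivial R] (hm : D.IsAdmissible m)
    (u v : FreeMonoid (Fin n)) (β : Fin n →₀ ℕ)
    (h : D.KillsRelators N fun t => wordExp t ≺[m] (wordExp u + β + wordExp v))
    {f : FreeAlgebra R (Fin n)} (hf : D.ReducesToZero f)
    (hs : f ∈ Submodule.span R (freeWord R '' {t | wordExp t ≺[m] β})) :
    N (freeWord R u * f * freeWord R v) = 0 := by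
  induction hf using Relation.ReflTransGen.head_induction_on with
  | refl => simp
  | @head f g hstep _ ih =>
    obtain ⟨i, j, hij, s, t, rfl⟩ := hstep
    -- At a word with coefficient zero the step changes nothing; such a word need not satisfy the
    -- bound.
    by_cases hc : wordCoeff f (s * FreeMonoid.of j * FreeMonoid.of i * t) = 0
    · simpa [hc] using ih (by simpa [hc] using hs)
    · have hlt := mem_span_freeWord_iff.mp hs _ hc
      simp only [Set.mem_ofPred_eq] at hlt
      have hrel : freeWord R s * D.relator i j * freeWord R t ∈
          Submodule.span R (freeWord R '' {t | wordExp t ≺[m] β}) := by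
        have hlead : freeWord R s * (FreeAlgebra.ι R j * FreeAlgebra.ι R i) * freeWord R t =
            freeWord R (s * FreeMonoid.of j * FreeMonoid.of i * t) := by
          simp [freeWord_mul, mul_assoc]
        rw [relator, mul_sub, sub_mul, hlead]
        refine Submodule.sub_mem _ (Submodule.subset_span ⟨_, hlt, rfl⟩)
          (mul_mem_span_freeWord s t (D.rhs_mem_span hm hij) fun w hw => ?_)
        refine lt_of_le_of_lt ?_ hlt
        rcases WordLT.mul hw s t with h1 | ⟨h1, -⟩
        · simpa only [mul_assoc] using h1.le
        · rw [h1]; simp only [mul_assoc, le_refl]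
      have h0 : N (freeWord R u * (freeWord R s * D.relator i j * freeWord R t) *
          freeWord R v) = 0 := by
        have := h (u * s) (t * v) i j hij (by
          simp only [wordExp_mul, map_add] at hlt ⊢
          have h2 : m.toSyn (wordExp u) + (m.toSyn (wordExp s) + m.toSyn (wordExp (.of j)) +
            m.toSyn (wordExp (.of i)) + m.toSyn (wordExp t)) + m.toSyn (wordExp v) <
            m.toSyn (wordExp u) + m.toSyn β + m.toSyn (wordExp v) := by gcongr
          simpa only [add_assoc] using h2)
        simpa only [freeWord_mul, mul_assoc] using this
      have h1 := ih (Submodule.sub_mem _ hs (Submodule.smul_mem _ _ hrel))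
      rw [← relator, mul_sub, sub_mul, map_sub, mul_smul_comm, smul_mul_assoc, map_smul, h0,
        smul_zero, sub_zero] at h1
      exact h1

/-- The two ways of rewriting `x_k x_j x_i` differ by the nondegeneracy element and relator
multiples whose leading words are rearrangements of `x_k x_j x_i` with smaller disorder. -/
theorem overlap_identity (i j k : Fin n) :
    FreeAlgebra.ι R k * D.relator i j - D.relator j k * FreeAlgebra.ι R i =
      D.nondegeneracy i j k
      + D.c j k • (FreeAlgebra.ι R j * D.relator i k)
      + (D.c j k * D.c i k) • (D.relator i j * FreeAlgebra.ι R k)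
      - D.c i j • (D.relator i k * FreeAlgebra.ι R j)
      - (D.c i j * D.c i k) • (FreeAlgebra.ι R i * D.relator j k) := by
  simp only [relator, rhs, nondegeneracy, mul_sub, sub_mul, mul_add, add_mul, smul_add, smul_sub,
    mul_smul_comm, smul_mul_assoc, smul_smul, mul_assoc]
  module

/-- Two overlapping descents of a word. -/
theorem KillsRelators.overlap [Nontrivial R] (hm : D.IsAdmissible m) {i j k : Fin n} (hij : i < j)
    (hjk : j < k) (hnd : D.ReducesToZero (D.nondegeneracy i j k)) (u v : FreeMonoid (Fin n))
    (h : D.KillsRelators N fun t => WordLT m t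
      (u * FreeMonoid.of k * FreeMonoid.of j * FreeMonoid.of i * v)) :
    N (freeWord R u * D.relator j k * freeWord R (FreeMonoid.of i * v)) =
      N (freeWord R (u * FreeMonoid.of k) * D.relator i j * freeWord R v) := by
  have hik := hij.trans hjk
  have hnd' := KillsRelators.map_reducesToZero (N := N) hm u v
    (Finsupp.single i 1 + Finsupp.single j 1 + Finsupp.single k 1)
    (fun s t a b hab hlt => h s t a b hab (Or.inl (by
      simp only [wordExp_mul, map_add, wordExp_of] at hlt ⊢
      convert hlt using 1
      abel))) hnd (nondegeneracy_mem_span hm hij hjk)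
  have e1 := h (u * .of j) v i k hik (by
    simpa only [mul_assoc] using WordLT.mul (wordLT_swap m hjk) u (.of i * v))
  have e2 := h u (.of k * v) i j hij (by
    have h1 := WordLT.mul (wordLT_swap m hik) (u * .of j) v
    have h2 := WordLT.mul (wordLT_swap m hjk) u (.of i * v)
    simp only [mul_assoc] at h1 h2 ⊢
    exact h1.trans h2)
  have e3 := h u (.of j * v) i k hik (by
    simpa only [mul_assoc] using WordLT.mul (wordLT_swap m hij) (u * .of k) v)
  have e4 := h (u * .of i) v j k hjk (by
    have h1 := WordLT.mul (wordLT_swap m hik) u (.of j * v)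
    have h2 := WordLT.mul (wordLT_swap m hij) (u * .of k) v
    simp only [mul_assoc] at h1 h2 ⊢
    exact h1.trans h2)
  have key : freeWord R (u * FreeMonoid.of k) * D.relator i j * freeWord R v -
      freeWord R u * D.relator j k * freeWord R (FreeMonoid.of i * v) =
      freeWord R u * (FreeAlgebra.ι R k * D.relator i j - D.relator j k * FreeAlgebra.ι R i) *
        freeWord R v := by
    simp only [freeWord_mul, freeWord_of]
    noncomm_ring
  rw [eq_comm, ← sub_eq_zero, ← map_sub, key, overlap_identity]
  simp only [mul_add, mul_sub, add_mul, sub_mul, mul_smul_comm, smul_mul_assoc, map_add, map_sub,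
    map_smul, hnd']
  simp only [freeWord_mul, freeWord_of, mul_assoc] at e1 e2 e3 e4 ⊢
  simp [e1, e2, e3, e4]

end Diamond

end CommRelations
end

/-! ### The diamond lemma and the basis of standard monomials. -/

noncomputable section
open scoped MonomialOrder

namespace CommRelations

variable {R : Type} [CommRing R] {n : ℕ} {D : CommRelations R n}

theorem KillsRelators.descents_eq [Nontrivial R] {m : MonomialOrder.{0, 0} (Fin n)}
    (hm : D.IsAdmissible m)
    (hnd : ∀ i j k : Fin n, i < j → j < k → D.ReducesToZero (D.nondegeneracy i j k))
    {M : Type} [AddCommGroup M] [Module R M] {N : FreeAlgebra R (Fin n) →ₗ[R] M}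
    {u v u' v' : FreeMonoid (Fin n)} {i j k l : Fin n} (hij : i < j) (hkl : k < l)
    (he : u * FreeMonoid.of j * FreeMonoid.of i * v =
      u' * FreeMonoid.of l * FreeMonoid.of k * v')
    (h : D.KillsRelators N fun t => WordLT m t (u * FreeMonoid.of j * FreeMonoid.of i * v)) :
    N (freeWord R u * D.relator i j * freeWord R v) =
      N (freeWord R u' * D.relator k l * freeWord R v') := by
  have main : ∀ {u v u' v' : FreeMonoid (Fin n)} {i j k l : Fin n} (s : List (Fin n)),
      i < j → k < l → u' = u * FreeMonoid.ofList s →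
      FreeMonoid.ofList (j :: i :: v.toList) = FreeMonoid.ofList (s ++ l :: k :: v'.toList) →
      (D.KillsRelators N fun t => WordLT m t (u * FreeMonoid.of j * FreeMonoid.of i * v)) →
      N (freeWord R u * D.relator i j * freeWord R v) =
        N (freeWord R u' * D.relator k l * freeWord R v') := by
    intro u v u' v' i j k l s hij hkl hu hs h
    have hs' : j :: i :: v.toList = s ++ l :: k :: v'.toList := FreeMonoid.ofList.injective hs
    subst hu
    -- The offset `s` between the two descents decides: empty, they coincide; one letter, they
    -- overlap; two or more, they are disjoint.
    match s, hs' with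
    | [], hs' =>
      simp only [List.nil_append, List.cons.injEq] at hs'
      obtain ⟨rfl, rfl, hv⟩ := hs'
      rw [FreeMonoid.toList.injective hv]
      simp
    | [x], hs' =>
      simp only [List.cons_append, List.nil_append, List.cons.injEq] at hs'
      obtain ⟨rfl, rfl, hv⟩ := hs'
      have hv' : v = FreeMonoid.of k * v' := FreeMonoid.toList.injective hv
      subst hv'
      exact KillsRelators.overlap hm hkl hij (hnd _ _ _ hkl hij) u v'
        (by simpa only [mul_assoc] using h)
    | x :: y :: t, hs' =>
      simp only [List.cons_append, List.cons.injEq] at hs'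
      obtain ⟨rfl, rfl, hv⟩ := hs'
      have hv' : v = FreeMonoid.ofList t * FreeMonoid.of l * FreeMonoid.of k * v' := by
        apply FreeMonoid.toList.injective
        simp [hv, FreeMonoid.toList_mul]
      subst hv'
      have hu : u * FreeMonoid.ofList (j :: i :: t) =
          u * FreeMonoid.of j * FreeMonoid.of i * FreeMonoid.ofList t := by
        simp only [mul_assoc]; rfl
      rw [hu]
      exact KillsRelators.disjoint hm hij hkl u _ v' (by simpa only [mul_assoc] using h)
  have hl := congrArg FreeMonoid.toList he
  simp only [FreeMonoid.toList_mul, FreeMonoid.toList_of, List.append_assoc,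
    List.singleton_append] at hl
  rcases List.append_eq_append_iff.mp hl with ⟨s, h1, h2⟩ | ⟨s, h1, h2⟩
  · exact main s hij hkl (FreeMonoid.toList.injective h1) (congrArg FreeMonoid.ofList h2) h
  · exact (main s hkl hij (FreeMonoid.toList.injective h1) (congrArg FreeMonoid.ofList h2)
      (by simpa only [he] using h)).symm

/-- The diamond lemma: if all overlaps resolve, there is a linear normal form which is constant on
classes modulo the relations and recovers the coefficients of a standard polynomial. -/
theorem exists_normalForm_killing [Nontrivial R] {m : MonomialOrder.{0, 0} (Fin n)}
    (hm : D.IsAdmissible m)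
    (hnd : ∀ i j k : Fin n, i < j → j < k → D.ReducesToZero (D.nondegeneracy i j k)) :
    ∃ N : FreeAlgebra R (Fin n) →ₗ[R] MvPolynomial (Fin n) R,
      (∀ a, N (stdPoly R n a) = a) ∧ D.KillsRelators N fun _ => True := by
  obtain ⟨N, hN1, hN2⟩ := D.exists_normalForm hm
  refine ⟨N, fun a => ?_, ?_⟩
  · have h : N ∘ₗ stdPoly R n = LinearMap.id := by
      refine (MvPolynomial.basisMonomials (Fin n) R).ext fun α => ?_
      simp [stdPoly_monomial, hN1]
    exact LinearMap.congr_fun h a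
  · have h : ∀ w, D.KillsRelators N fun t => t = w := by
      intro w
      induction w using (wellFounded_wordLT m).induction with
      | h w ih =>
        rintro u v i j hij rfl
        obtain ⟨u', v', k, l, hkl, he, h0⟩ := hN2 _ (not_isChain_descent hij u v)
        rw [KillsRelators.descents_eq hm hnd hij hkl he, h0]
        exact fun s t a b hab hlt => ih _ hlt s t a b hab rfl
    exact fun u v i j hij _ => h _ u v i j hij rfl

theorem KillsRelators.mul_relator_mul {M : Type} [AddCommGroup M] [Module R M]
    {N : FreeAlgebra R (Fin n) →ₗ[R] M} (h : D.KillsRelators N fun _ => True) {i j : Fin n}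
    (hij : i < j) (f g : FreeAlgebra R (Fin n)) : N (f * D.relator i j * g) = 0 := by
  have h1 : ∀ v f, N (f * D.relator i j * freeWord R v) = 0 := by
    intro v f
    have : N ∘ₗ (LinearMap.mulRight R (freeWord R v)) ∘ₗ
        (LinearMap.mulRight R (D.relator i j)) = 0 := by
      refine (FreeAlgebra.basisFreeMonoid R (Fin n)).ext fun u => ?_
      simpa [basisFreeMonoid_apply] using h u v i j hij trivial
    simpa using LinearMap.congr_fun this f
  have : N ∘ₗ (LinearMap.mulLeft R (f * D.relator i j)) = 0 := by
    refine (FreeAlgebra.basisFreeMonoid R (Fin n)).ext fun u => ?_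
    simpa [basisFreeMonoid_apply, mul_assoc] using h1 u f
  simpa [mul_assoc] using LinearMap.congr_fun this g

/-- Equality in the quotient is the equivalence closure of `RingQuot.Rel`. Invariance of `N` is
proved inside arbitrary two-sided factors `f`, `g`, so that the induction passes through the
multiplication rules. -/
theorem KillsRelators.eq_of_mkAlgHom_eq {M : Type} [AddCommGroup M] [Module R M]
    {N : FreeAlgebra R (Fin n) →ₗ[R] M} (h : D.KillsRelators N fun _ => True)
    {a b : FreeAlgebra R (Fin n)} (hab : RingQuot.mkAlgHom R D.Rel a = RingQuot.mkAlgHom R D.Rel b) :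
    N a = N b := by
  have hrel : ∀ a b, RingQuot.Rel D.Rel a b → ∀ f g, N (f * a * g) = N (f * b * g) := by
    intro a b hr
    induction hr with
    | of hr =>
      obtain ⟨i, j, hij⟩ := hr
      intro f g
      rw [← sub_eq_zero, ← map_sub, ← sub_mul, ← mul_sub]
      exact h.mul_relator_mul hij f g
    | add_left _ ih => intro f g; simp only [mul_add, add_mul, map_add, ih]
    | mul_left _ ih =>
      intro f g
      simpa only [mul_assoc] using ih f _
    | mul_right _ ih =>
      intro f g
      simpa only [mul_assoc] using ih (f * _) g
  have hq : Quot.mk (RingQuot.Rel D.Rel) a = Quot.mk (RingQuot.Rel D.Rel) b := by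
    simpa [RingQuot.mkAlgHom, RingQuot.mkRingHom] using hab
  have hg := Quot.eqvGen_exact hq
  clear hab hq
  induction hg with
  | rel x y hr => simpa using hrel x y hr 1 1
  | refl => rfl
  | symm x y _ ih => exact ih.symm
  | trans x y z _ _ ih1 ih2 => exact ih1.trans ih2

/-- The standard monomials of a `G`-algebra are linearly independent. -/
theorem std_injective [Nontrivial R] {m : MonomialOrder.{0, 0} (Fin n)} (hm : D.IsAdmissible m)
    (hnd : ∀ i j k : Fin n, i < j → j < k → D.ReducesToZero (D.nondegeneracy i j k)) :
    Function.Injective D.std := by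
  obtain ⟨N, hN1, hN2⟩ := exists_normalForm_killing hm hnd
  intro a b hab
  rw [← hN1 a, ← hN1 b]
  exact hN2.eq_of_mkAlgHom_eq hab

/-- The standard monomials span the algebra. -/
theorem std_surjective {m : MonomialOrder.{0, 0} (Fin n)} (hm : D.IsAdmissible m) :
    Function.Surjective D.std := by
  have hstd : ∀ α, RingQuot.mkAlgHom R D.Rel (stdMonomial R α) ∈ LinearMap.range D.std :=
    fun α => ⟨MvPolynomial.monomial α 1, by simp [std, stdPoly_monomial]⟩
  have hw : ∀ w, RingQuot.mkAlgHom R D.Rel (freeWord R w) ∈ LinearMap.range D.std := by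
    intro w
    induction w using (wellFounded_wordLT m).induction with
    | h w ih =>
      rcases isChain_or_exists_descent w with hw | ⟨u, v, i, j, hij, rfl⟩
      · rw [eq_stdWord_of_isChain hw, ← stdMonomial_eq_freeWord]
        exact hstd _
      · have h1 : RingQuot.mkAlgHom R D.Rel (freeWord R (u * .of j * .of i * v)) =
            RingQuot.mkAlgHom R D.Rel (freeWord R u * D.rhs i j * freeWord R v) := by
          have := RingQuot.mkAlgHom_rel R (Rel.comm (D := D) i j hij)
          simp only [freeWord_mul, freeWord_of, map_mul] at this ⊢
          rw [← this]
          simp only [mul_assoc]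
        rw [h1]
        have h2 := mul_mem_span_freeWord u v (D.rhs_mem_span hm hij)
          (t := {t | WordLT m t (u * .of j * .of i * v)}) fun t ht => by
            simpa only [mul_assoc, Set.mem_ofPred_eq] using WordLT.mul ht u v
        have h3 : Submodule.span R (freeWord R '' {t | WordLT m t (u * .of j * .of i * v)}) ≤
            (LinearMap.range D.std).comap (RingQuot.mkAlgHom R D.Rel).toLinearMap := by
          rw [Submodule.span_le]
          rintro _ ⟨t, ht, rfl⟩
          exact ih t ht
        exact h3 h2
  intro x
  obtain ⟨f, rfl⟩ := RingQuot.mkAlgHom_surjective R D.Rel x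
  have h : f ∈ (LinearMap.range D.std).comap (RingQuot.mkAlgHom R D.Rel).toLinearMap := by
    have := (FreeAlgebra.basisFreeMonoid R (Fin n)).mem_span f
    refine Submodule.span_le.mpr ?_ this
    rintro _ ⟨w, rfl⟩
    rw [basisFreeMonoid_apply]
    exact hw w
  exact h

/-! ### Projections to homogeneous parts. -/

section Grading

variable {ω : Fin n → ℕ}

/-- The homomorphism multiplying each variable by the power of an indeterminate given by
its weight. -/
def homogenizeFree (D : CommRelations R n) (ω : Fin n → ℕ) :
    FreeAlgebra R (Fin n) →ₐ[R] Polynomial D.Alg :=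
  FreeAlgebra.lift R fun i =>
    Polynomial.monomial (ω i) (RingQuot.mkAlgHom R D.Rel (FreeAlgebra.ι R i))

theorem homogenizeFree_stdMonomial (α : Fin n →₀ ℕ) :
    D.homogenizeFree ω (stdMonomial R α) = Polynomial.monomial (Finsupp.weight ω α)
      (RingQuot.mkAlgHom R D.Rel (stdMonomial R α)) := by
  have h : ∀ l : List (Fin n),
      D.homogenizeFree ω (l.map fun i => FreeAlgebra.ι R i ^ α i).prod =
      Polynomial.monomial (l.map fun i => α i * ω i).sum
        (RingQuot.mkAlgHom R D.Rel (l.map fun i => FreeAlgebra.ι R i ^ α i).prod) := by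
    intro l
    induction l with
    | nil => simp
    | cons a l ih =>
      simp only [List.map_cons, List.prod_cons, List.sum_cons, map_mul, map_pow, ih]
      rw [← Polynomial.monomial_mul_monomial]
      congr 1
      rw [homogenizeFree, FreeAlgebra.lift_ι_apply, Polynomial.monomial_pow, mul_comm]
  rw [stdMonomial, h, Finsupp.weight_apply, Finsupp.sum_fintype _ _ (by simp), ← List.sum_ofFn,
    List.ofFn_eq_map]
  simp

theorem homogenizeFree_stdPoly {a : MvPolynomial (Fin n) R} {e : ℕ}
    (ha : a.IsWeightedHomogeneous ω e) :
    D.homogenizeFree ω (stdPoly R n a) = Polynomial.monomial e (D.std a) := by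
  conv_lhs => rw [a.as_sum]
  conv_rhs => rw [a.as_sum]
  rw [map_sum, map_sum, map_sum, map_sum]
  refine Finset.sum_congr rfl fun α hα => ?_
  rw [stdPoly_monomial, map_smul, homogenizeFree_stdMonomial, ha (MvPolynomial.mem_support_iff.mp hα)]
  rw [std, LinearMap.comp_apply, stdPoly_monomial, map_smul, Polynomial.smul_monomial,
    AlgHom.toLinearMap_apply]

/-- The homomorphism multiplying each homogeneous element by the power of an indeterminate given by
its degree. -/
def homogenize (hgr : D.IsGradedBy ω) : D.Alg →ₐ[R] Polynomial D.Alg :=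
  RingQuot.liftAlgHom R ⟨D.homogenizeFree ω, by
    rintro _ _ ⟨i, j, hij⟩
    rw [rhs, map_add, homogenizeFree_stdPoly (hgr i j hij), map_smul, map_mul, map_mul]
    have h := RingQuot.mkAlgHom_rel R (Rel.comm (D := D) i j hij)
    simp only [homogenizeFree, FreeAlgebra.lift_ι_apply, Polynomial.monomial_mul_monomial,
      ← map_mul, h, Polynomial.smul_monomial, add_comm (ω j)]
    rw [← map_add]
    simp [rhs, std]⟩

theorem homogenize_std (hgr : D.IsGradedBy ω) {a : MvPolynomial (Fin n) R} {e : ℕ}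
    (ha : a.IsWeightedHomogeneous ω e) :
    homogenize hgr (D.std a) = Polynomial.monomial e (D.std a) := by
  rw [← homogenizeFree_stdPoly ha]
  exact RingQuot.liftAlgHom_mkAlgHom_apply _ _ _ _

/-- The projection of the algebra to its homogeneous part of degree `e`. -/
def homogeneousProj (hgr : D.IsGradedBy ω) (e : ℕ) : D.Alg →ₗ[R] D.Alg :=
  (Polynomial.lcoeff D.Alg e).restrictScalars R ∘ₗ (homogenize hgr).toLinearMap

theorem homogeneousProj_std_of_homogeneous (hgr : D.IsGradedBy ω) {a : MvPolynomial (Fin n) R}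
    {e' : ℕ} (ha : a.IsWeightedHomogeneous ω e') (e : ℕ) :
    homogeneousProj hgr e (D.std a) = if e' = e then D.std a else 0 := by
  simp only [homogeneousProj, LinearMap.comp_apply, AlgHom.toLinearMap_apply, homogenize_std hgr ha,
    LinearMap.restrictScalars_apply, Polynomial.lcoeff_apply, Polynomial.coeff_monomial]

/-- The projection comes from an algebra homomorphism, so taking components of coefficient vectors
is compatible with `std` even if standard monomials were dependent. -/
theorem homogeneousProj_std (hgr : D.IsGradedBy ω) (e : ℕ) (a : MvPolynomial (Fin n) R) :
    homogeneousProj hgr e (D.std a) =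
      D.std (MvPolynomial.weightedHomogeneousComponent ω e a) := by
  have h : homogeneousProj hgr e ∘ₗ D.std =
      D.std ∘ₗ MvPolynomial.weightedHomogeneousComponent ω e := by
    refine (MvPolynomial.basisMonomials (Fin n) R).ext fun α => ?_
    have hα := MvPolynomial.isWeightedHomogeneous_monomial ω α (1 : R) rfl
    rw [MvPolynomial.coe_basisMonomials, LinearMap.comp_apply, LinearMap.comp_apply,
      homogeneousProj_std_of_homogeneous hgr hα, MvPolynomial.weightedHomogeneousComponent_of_mem hα]
    by_cases h : Finsupp.weight ω α = e
    · rw [if_pos h, if_pos h.symm]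
    · rw [if_neg h, if_neg (Ne.symm h), map_zero]
  exact LinearMap.congr_fun h a

theorem homogeneousProj_mem (hgr : D.IsGradedBy ω) {I : Ideal D.Alg} (hI : D.IsGradedIdeal ω I)
    (e : ℕ) {f : D.Alg} (hf : f ∈ I) : homogeneousProj hgr e f ∈ I := by
  have h : f ∈ ⨆ e : ℕ, D.idealPart ω I e := by
    rw [← hI]; exact hf
  clear hf
  induction h using Submodule.iSup_induction' with
  | mem e' x hx =>
    obtain ⟨a, ha, rfl⟩ := hx.2
    rw [homogeneousProj_std_of_homogeneous hgr ha]
    split_ifs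
    · exact hx.1
    · exact I.zero_mem
  | zero => simp
  | add x y _ _ hx hy => rw [map_add]; exact I.add_mem hx hy

end Grading

end CommRelations
end

/-! ### Comparing ranks of lattices with dimensions. -/

noncomputable section
open scoped MonomialOrder

/-- Clearing denominators turns a rational dependence between images of a `ℤ`-basis into an integral
one. -/
theorem finrank_int_le_finrank_rat {L V : Type*} [AddCommGroup L] [inst : Module ℤ L]
    [Module.Free ℤ L] [Module.Finite ℤ L] [AddCommGroup V] [Module ℚ V] [Module.Finite ℚ V]
    (f : L →+ V) (hf : Function.Injective f) : Module.finrank ℤ L ≤ Module.finrank ℚ V := by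
  obtain rfl : inst = AddCommGroup.toIntModule L := Subsingleton.elim _ _
  let b := Module.finBasis ℤ L
  have h1 : LinearIndependent ℤ (f.toIntLinearMap ∘ b) :=
    b.linearIndependent.map' _ (LinearMap.ker_eq_bot.mpr hf)
  rw [LinearIndependent.iff_fractionRing ℤ ℚ] at h1
  simpa using h1.fintype_card_le_finrank

/-- The images of a `ℤ`-basis span a `K`-space containing `S`; the image of `g` itself need not be a
subspace. -/
theorem finrank_le_finrank_int {K L W : Type*} [Field K] [AddCommGroup L] [inst : Module ℤ L]
    [Module.Free ℤ L] [Module.Finite ℤ L] [AddCommGroup W] [Module K W] (g : L →+ W)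
    (S : Submodule K W) (hS : ∀ x ∈ S, ∃ l, g l = x) :
    Module.finrank K S ≤ Module.finrank ℤ L := by
  obtain rfl : inst = AddCommGroup.toIntModule L := Subsingleton.elim _ _
  let b := Module.finBasis ℤ L
  have hle : S ≤ Submodule.span K (Set.range (g ∘ b)) := by
    intro x hx
    obtain ⟨l, rfl⟩ := hS x hx
    rw [← b.sum_repr l, map_sum]
    refine Submodule.sum_mem _ fun k _ => ?_
    rw [map_zsmul]
    exact zsmul_mem (Submodule.subset_span (Set.mem_range_self k)) _
  have : Module.Finite K (Submodule.span K (Set.range (g ∘ b))) :=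
    Module.Finite.span_of_finite K (Set.finite_range _)
  refine (Submodule.finrank_mono hle).trans ?_
  exact (finrank_range_le_card (R := K) (g ∘ b)).trans_eq (Fintype.card_fin _)

namespace CommRelations

section Basic

variable {R : Type} [CommRing R] {n : ℕ} {D : CommRelations R n}

theorem isAdmissible_of_lt {m : MonomialOrder.{0, 0} (Fin n)}
    (h : ∀ i j : Fin n, i < j → ∀ α, (D.d i j).coeff α ≠ 0 →
      α ≺[m] (Finsupp.single i 1 + Finsupp.single j 1)) : D.IsAdmissible m := by
  intro i j hij
  by_cases h0 : D.d i j = 0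
  · exact Or.inl h0
  · exact Or.inr (h i j hij _ (MvPolynomial.mem_support_iff.mp (m.degree_mem_support h0)))

end Basic

/-! ### Change of coefficients and reduction modulo a prime. -/

variable {n : ℕ} {D : CommRelations ℤ n}

theorem coeff_baseChange_d (S : Type) [CommRing S] (i j : Fin n) (α : Fin n →₀ ℕ) :
    ((D.baseChange S).d i j).coeff α = (((D.d i j).coeff α : ℤ) : S) := by
  simp [baseChange, MvPolynomial.coeff_map]

theorem IsAdmissible.of_baseChange_rat {m : MonomialOrder.{0, 0} (Fin n)}
    (h : (D.baseChange ℚ).IsAdmissible m) : D.IsAdmissible m :=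
  isAdmissible_of_lt fun i j hij α hα => h.lt_of_mem_support hij (by
    rw [MvPolynomial.mem_support_iff, coeff_baseChange_d]
    exact_mod_cast hα)

theorem IsAdmissible.baseChange {m : MonomialOrder.{0, 0} (Fin n)} (h : D.IsAdmissible m)
    (S : Type) [CommRing S] : (D.baseChange S).IsAdmissible m :=
  isAdmissible_of_lt fun i j hij α hα => h.lt_of_mem_support hij (by
    rw [MvPolynomial.mem_support_iff]
    rintro h0
    rw [coeff_baseChange_d, h0, Int.cast_zero] at hα
    exact hα rfl)

theorem IsGradedBy.baseChange_of_rat {ω : Fin n → ℕ} (h : (D.baseChange ℚ).IsGradedBy ω)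
    (S : Type) [CommRing S] : (D.baseChange S).IsGradedBy ω := by
  intro i j hij α hα
  refine h i j hij ?_
  rw [coeff_baseChange_d] at hα ⊢
  intro h0
  rw [Int.cast_eq_zero.mp h0, Int.cast_zero] at hα
  exact hα rfl

/-- The change of coefficients on free algebras. -/
def freeCast (n : ℕ) (S : Type) [CommRing S] : FreeAlgebra ℤ (Fin n) →+* FreeAlgebra S (Fin n) :=
  (FreeAlgebra.lift ℤ (FreeAlgebra.ι S)).toRingHom

@[simp] theorem freeCast_ι (S : Type) [CommRing S] (i : Fin n) :
    freeCast n S (FreeAlgebra.ι ℤ i) = FreeAlgebra.ι S i :=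
  FreeAlgebra.lift_ι_apply _ _

theorem freeCast_algebraMap (S : Type) [CommRing S] (r : ℤ) :
    freeCast n S (algebraMap ℤ _ r) = algebraMap S _ (r : S) := by
  rw [eq_intCast, map_intCast, map_intCast]

theorem freeCast_stdPoly (S : Type) [CommRing S] (a : MvPolynomial (Fin n) ℤ) :
    freeCast n S (stdPoly ℤ n a) = stdPoly S n (MvPolynomial.map (Int.castRingHom S) a) := by
  conv_lhs => rw [a.as_sum]
  conv_rhs => rw [a.as_sum]
  simp only [map_sum]
  refine Finset.sum_congr rfl fun α _ => ?_
  rw [stdPoly_monomial, MvPolynomial.map_monomial, stdPoly_monomial, Algebra.smul_def, map_mul,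
    freeCast_algebraMap, ← Algebra.smul_def, stdMonomial, stdMonomial, map_list_prod, List.map_map, eq_intCast]
  simp [Function.comp_def]

/-- The homomorphism from the integral form of the algebra to its base change. -/
def algCast (D : CommRelations ℤ n) (S : Type) [CommRing S] :
    D.Alg →+* (D.baseChange S).Alg :=
  RingQuot.lift ⟨(RingQuot.mkAlgHom S (D.baseChange S).Rel).toRingHom.comp (freeCast n S), by
    rintro _ _ ⟨i, j, hij⟩
    have h : freeCast n S (D.rhs i j) = (D.baseChange S).rhs i j := by
      rw [rhs, map_add, Algebra.smul_def, map_mul, freeCast_algebraMap, ← Algebra.smul_def,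
        freeCast_stdPoly, map_mul, freeCast_ι, freeCast_ι]
      rfl
    change RingQuot.mkAlgHom S _ (freeCast n S _) = RingQuot.mkAlgHom S _ (freeCast n S _)
    rw [h, map_mul, freeCast_ι, freeCast_ι]
    exact RingQuot.mkAlgHom_rel S (Rel.comm (D := D.baseChange S) i j hij)⟩

theorem algCast_std (S : Type) [CommRing S] (a : MvPolynomial (Fin n) ℤ) :
    D.algCast S (D.std a) = D.intStd S a := by
  have h : D.std a = RingQuot.mkRingHom D.Rel (stdPoly ℤ n a) := by
    rw [← RingQuot.mkAlgHom_coe ℤ]; rfl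
  rw [h, algCast, RingQuot.lift_mkRingHom_apply]
  change RingQuot.mkAlgHom S _ (freeCast n S _) = _
  rw [freeCast_stdPoly]
  rfl

theorem intStd_add (S : Type) [CommRing S] (a b : MvPolynomial (Fin n) ℤ) :
    D.intStd S (a + b) = D.intStd S a + D.intStd S b := by
  simp [intStd]

/-- Straightening the product in the algebra over `ℤ` yields one integer vector valid over every
`S`, in particular over `ℚ` and modulo `p` simultaneously. -/
theorem exists_intStd_eq_mul (hs : Function.Surjective D.std) (a b : MvPolynomial (Fin n) ℤ) :
    ∃ c, ∀ (S : Type) [CommRing S], D.intStd S c = D.intStd S a * D.intStd S b := by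
  obtain ⟨c, hc⟩ := hs (D.std a * D.std b)
  exact ⟨c, fun S _ => by rw [← algCast_std, hc, map_mul, algCast_std, algCast_std]⟩

theorem intStd_zmod_surjective {m : MonomialOrder.{0, 0} (Fin n)} (h : D.IsAdmissible m) (N : ℕ) :
    Function.Surjective (D.intStd (ZMod N)) :=
  (std_surjective (h.baseChange _)).comp
    (MvPolynomial.map_surjective _ (ZMod.ringHom_surjective _))

theorem homogeneousProj_intStd {ω : Fin n → ℕ} (S : Type) [CommRing S]
    (hgr : (D.baseChange S).IsGradedBy ω) (e : ℕ) (a : MvPolynomial (Fin n) ℤ) :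
    homogeneousProj hgr e (D.intStd S a) =
      D.intStd S (MvPolynomial.weightedHomogeneousComponent ω e a) := by
  classical
  rw [intStd, homogeneousProj_std, intStd]
  congr 1
  ext α
  simp only [MvPolynomial.coeff_weightedHomogeneousComponent, MvPolynomial.coeff_map]
  split_ifs <;> simp

/-- The reductions are closed under left multiplication: a multiplier modulo `N` lifts to an
integral element, and the product of the lifts is again integral and in `I`. -/
theorem exists_of_mem_reductionMod {m : MonomialOrder.{0, 0} (Fin n)} (hm : D.IsAdmissible m)
    {N : ℕ} {I : Ideal (D.baseChange ℚ).Alg} {g : (D.baseChange (ZMod N)).Alg}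
    (hg : g ∈ D.reductionMod N I) : ∃ a, D.intStd ℚ a ∈ I ∧ D.intStd (ZMod N) a = g := by
  induction hg using Submodule.span_induction with
  | mem x hx =>
    obtain ⟨f, ⟨hf, -⟩, a, rfl, rfl⟩ := hx
    exact ⟨a, hf, rfl⟩
  | zero => exact ⟨0, by simp [intStd], by simp [intStd]⟩
  | add x y _ _ hx hy =>
    obtain ⟨a, ha, rfl⟩ := hx
    obtain ⟨b, hb, rfl⟩ := hy
    exact ⟨a + b, by rw [intStd_add]; exact I.add_mem ha hb, intStd_add _ _ _⟩
  | smul r x _ hx =>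
    obtain ⟨a, ha, rfl⟩ := hx
    obtain ⟨b, rfl⟩ := intStd_zmod_surjective hm N r
    obtain ⟨c, hc⟩ := exists_intStd_eq_mul (std_surjective hm) b a
    exact ⟨c, by rw [hc]; exact I.mul_mem_left _ ha, hc _⟩

theorem isWeightedHomogeneous_map_intCast {ω : Fin n → ℕ} (S : Type) [CommRing S]
    {a : MvPolynomial (Fin n) ℤ} {e : ℕ} (ha : a.IsWeightedHomogeneous ω e) :
    (MvPolynomial.map (Int.castRingHom S) a).IsWeightedHomogeneous ω e := by
  intro α hα
  refine ha fun h0 => hα ?_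
  rw [MvPolynomial.coeff_map, h0, map_zero]

/-- The lattice of coefficient vectors of the integral elements of degree `e` of a left ideal. -/
def integralPart (D : CommRelations ℤ n) (ω : Fin n → ℕ) (I : Ideal (D.baseChange ℚ).Alg)
    (e : ℕ) : Submodule ℤ (MvPolynomial (Fin n) ℤ) where
  carrier := {a | a.IsWeightedHomogeneous ω e ∧ D.intStd ℚ a ∈ I}
  zero_mem' := ⟨MvPolynomial.isWeightedHomogeneous_zero _ _ _, by simp [intStd]⟩
  add_mem' ha hb := ⟨ha.1.add hb.1, by rw [intStd_add]; exact I.add_mem ha.2 hb.2⟩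
  smul_mem' r a ha := ⟨(MvPolynomial.weightedHomogeneousSubmodule ℤ ω e).smul_mem r ha.1, by
    have h : D.intStd ℚ (r • a) = r • D.intStd ℚ a :=
      map_zsmul (AddMonoidHom.mk' (D.intStd ℚ) (intStd_add ℚ)) r a
    rw [h]
    exact zsmul_mem ha.2 r⟩

theorem integralPart_finite {ω : Fin n → ℕ} (hω : ∀ i, 1 ≤ ω i)
    (I : Ideal (D.baseChange ℚ).Alg) (e : ℕ) : Module.Finite ℤ (D.integralPart ω I e) := by
  have h : IsNoetherian ℤ (MvPolynomial.weightedHomogeneousSubmodule ℤ ω e) :=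
    isNoetherian_of_fg_of_noetherian _ (MvPolynomial.weightedHomogeneousSubmodule_fg (R := ℤ) ω
      (fun i => Nat.one_le_iff_ne_zero.mp (hω i)) e)
  have h2 : IsNoetherian ℤ (D.integralPart ω I e) := isNoetherian_of_le
    (t := MvPolynomial.weightedHomogeneousSubmodule ℤ ω e) fun a ha => ha.1
  infer_instance

end CommRelations
end

open CommRelations

theorem lemma3p8 (n : ℕ) (D : CommRelations ℤ n) (hG : (D.baseChange ℚ).IsGAlgebra)
    (ω : Fin n → ℕ) (hω : ∀ i, 1 ≤ ω i) (hgr : (D.baseChange ℚ).IsGradedBy ω)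
    (I : Ideal (D.baseChange ℚ).Alg) (hI : (D.baseChange ℚ).IsGradedIdeal ω I)
    (p : ℕ) (hp : p.Prime) (e : ℕ) :
    (D.baseChange (ZMod p)).hilbertFunction ω (D.reductionMod p I) e
      ≤ (D.baseChange ℚ).hilbertFunction ω I e := by
  obtain ⟨m, hm⟩ := hG.exists_admissible
  have hmZ := hm.of_baseChange_rat
  have hinj := std_injective hm hG.nondegenerate
  have hgrp := hgr.baseChange_of_rat (ZMod p)
  have := Fact.mk hp
  have := integralPart_finite (D := D) hω I e
  have := idealPart_finite (D.baseChange ℚ) hω I e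
  let f : D.integralPart ω I e →+ (D.baseChange ℚ).idealPart ω I e :=
    AddMonoidHom.mk' (fun a => ⟨D.intStd ℚ a, a.2.2, _, isWeightedHomogeneous_map_intCast ℚ a.2.1, rfl⟩)
      fun a b => Subtype.ext (intStd_add _ _ _)
  have hf : Function.Injective f := fun a b hab => Subtype.ext
    (MvPolynomial.map_injective _ (RingHom.injective_int _) (hinj (congrArg Subtype.val hab)))
  let g : D.integralPart ω I e →+ (D.baseChange (ZMod p)).Alg :=
    AddMonoidHom.mk' (fun a => D.intStd (ZMod p) a) fun a b => intStd_add _ _ _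
  refine (finrank_le_finrank_int g _ ?_).trans (finrank_int_le_finrank_rat f hf)
  rintro x ⟨hx, c, hc, rfl⟩
  obtain ⟨a, ha, hax⟩ := exists_of_mem_reductionMod hmZ hx
  -- The lift `a` need not be homogeneous. Its degree `e` component stays in `I` because `I` is
  -- graded, and still reduces to the given element, which is itself of degree `e`.
  refine ⟨⟨MvPolynomial.weightedHomogeneousComponent ω e a,
    MvPolynomial.weightedHomogeneousComponent_isWeightedHomogeneous _ _, ?_⟩, ?_⟩
  · rw [← homogeneousProj_intStd ℚ hgr]
    exact homogeneousProj_mem hgr hI e ha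
  · change D.intStd (ZMod p) _ = _
    rw [← homogeneousProj_intStd (ZMod p) hgrp, hax, homogeneousProj_std_of_homogeneous hgrp hc,
      if_pos rfl]
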